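/- Let $A=\mathbb{Z}[u_1,u_2,\ldots]$ be the polynomial ring in countably many commuting variables, with $u_0=1$ and $u_r=0$ for $r<0$. For an integer vector $\alpha=(\alpha_1,\alpha_2,\ldots)$ (finitely many non-zero terms, the last of them $\alpha_\ell$) put $u_\alpha=\prod_i u_{\alpha_i}$ and $U_\alpha=\prod_{1\le i<j\le \ell}(1-R_{ij})\,u_\alpha$. Here $R_{ij}$ is the raising operator $R_{ij}(\alpha)=(\ldots,\alpha_i+1,\ldots,\alpha_j-1,\ldots)$, acting on indices: if $\psi$ is the $\mathbb{Z}$-linear map from the group algebra of integer vectors to $A$ with $\psi(x^\alpha)=u_\alpha$, then $U_\alpha=\psi\bigl(\prod_{i<j\le\ell}(1-x_ix_j^{-1})\,x^\alpha\bigr)$. Let $\omega:A\to A$ be the ring homomorphism with $\omega(u_r)=U_{(1^r)}$ for $r\ge 1$. Write $\lambda'$ for the conjugate of a partition $\lambda$, and $\mu\subset\lambda$ for containment of Young diagrams. The $U_\lambda$, for $\lambda$ a partition, form a $\mathbb{Z}$-basis of $A$, so that integers $K_{\lambda/\mu,\alpha}$ and $c^\lambda_{\mu\nu}$ ($\lambda,\mu,\nu$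 partitions, $\alpha$ an integer vector) are defined by the finite expansions $$u_\alpha U_\mu=\sum_{\lambda\supset\mu}K_{\lambda/\mu,\alpha}\,U_\lambda,\qquad U_\mu U_\nu=\sum_\lambda c^\lambda_{\mu\nu}\,U_\lambda ,$$ where only partitions $\lambda\supset\mu$ occur in the first one. For all $\mu\subset\lambda$ only finitely many partitions $\nu$ satisfy $K_{\lambda/\mu,\nu}\ne0$; the equations $U_\lambda=\sum_\nu K_{\lambda/\emptyset,\nu}\,t_\nu$ (all partitions $\lambda$) have a unique solution $(t_\nu)$ in $A$, and it is a $\mathbb{Z}$-basis of $A$. For $\mu\subset\lambda$ define the skew Schur polynomial $U_{\lambda/\mu}:=\sum_\nu K_{\lambda/\mu,\nu}\,t_\nu$. Then: 1. for all partitions $\mu\subset\lambda$, only finitely many $\nu$ satisfy $c^\lambda_{\mu\nu}\neq 0$, and $U_{\lambda/\mu}=\sum_\nu c^\lambda_{\mu\nu}\,U_\nu$; 2. $c^\lambda_{\mu\nu}=c^{\lambda'}_{\mu'\nu'}$ for all partitions $\lambda,\mu,\nu$; 3. $\omega(U_{\lambda/\mu})=U_{\lambda'/\mu'}$ for all partitions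 $\mu\subset\lambda$. -/

import Mathlib

namespace SchurAlg

/-- The polynomial ring `ℤ[u₁, u₂, …]`; the variable `X n` stands for `u_{n+1}`. -/
abbrev A : Type := MvPolynomial ℕ ℤ

/-- `u r` for an integer `r`, with `u 0 = 1` and `u r = 0` for `r < 0`. -/
noncomputable def u : ℤ → A
  | Int.ofNat 0 => 1
  | Int.ofNat (n + 1) => MvPolynomial.X n
  | Int.negSucc _ => 0

/-- Integer vectors: integer sequences with finitely many non-zero terms, indexed from `0`. -/
abbrev IntVec : Type := ℕ →₀ ℤ

/-- The length of an integer vector: the number of terms up to and including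
the last non-zero one. -/
def length (al : IntVec) : ℕ := al.support.sup (fun i => i + 1)

/-- The monomial `u_α = ∏ᵢ u_{αᵢ}` (the terms with `αᵢ = 0` contribute `u 0 = 1`). -/
noncomputable def uMon (al : IntVec) : A := ∏ i ∈ al.support, u (al i)

/-- The raising operator `R_{ij}`, as the Laurent monomial `xᵢ xⱼ⁻¹` in the group algebra of the
group of integer vectors: multiplication by it sends `x^α` to `x^{R_{ij} α}`. -/
noncomputable def raising (i j : ℕ) : AddMonoidAlgebra ℤ IntVec :=
  AddMonoidAlgebra.single (Finsupp.single i 1 - Finsupp.single j 1) 1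

/-- The `ℤ`-linear map from the group algebra of integer vectors to `A` with `x^α ↦ u_α`. -/
noncomputable def psi (f : AddMonoidAlgebra ℤ IntVec) : A :=
  Finsupp.linearCombination ℤ uMon f.coeff

/-- The Schur polynomial `U_α = ∏_{i<j} (1 - R_{ij}) u_α` of an integer vector `α`. The product
runs over the pairs of positions below the length of `α`. -/
noncomputable def schurVec (al : IntVec) : A :=
  psi ((∏ j ∈ Finset.range (length al), ∏ i ∈ Finset.range j, (1 - raising i j)) *
    AddMonoidAlgebra.single al 1)

/-- A partition, given by its Young diagram, as the integer vector of its row lengths. -/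
noncomputable def toVec (lam : YoungDiagram) : IntVec :=
  Finsupp.onFinset (Finset.range (lam.colLen 0)) (fun i => (lam.rowLen i : ℤ)) (by
    intro i hi
    have h : 0 < lam.rowLen i := by
      have h0 : lam.rowLen i ≠ 0 := by exact_mod_cast hi
      omega
    rw [Finset.mem_range, ← YoungDiagram.mem_iff_lt_colLen]
    exact YoungDiagram.mem_iff_lt_rowLen.mpr h)

/-- The Schur polynomial `U_λ` of a partition. -/
noncomputable def U (lam : YoungDiagram) : A := schurVec (toVec lam)

/-- The coefficients of an element of `A` in the family of the `U_λ`, `λ` a partition. -/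
noncomputable def schurCoeff (f : A) : YoungDiagram →₀ ℤ :=
  Classical.epsilon fun c => Finsupp.linearCombination ℤ U c = f

/-- The Kostka number `K_{λ/μ,α}`: the coefficient of `U_λ` in `u_α U_μ`. -/
noncomputable def kostka (lam mu : YoungDiagram) (al : IntVec) : ℤ :=
  schurCoeff (uMon al * U mu) lam

/-- The Littlewood-Richardson coefficient `c^λ_{μν}`: the coefficient of `U_λ` in `U_μ U_ν`. -/
noncomputable def lr (lam mu nu : YoungDiagram) : ℤ := schurCoeff (U mu * U nu) lam

/-- The transition equations `U_λ = ∑_μ K_{λ,μ} t_μ`, for all partitions `λ`. -/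
def IsTransition (t : YoungDiagram → A) : Prop :=
  ∀ lam : YoungDiagram, U lam = ∑ᶠ mu : YoungDiagram, kostka lam ⊥ (toVec mu) • t mu

/-- The family `t_λ` that is determined by the transition equations. -/
noncomputable def tPoly : YoungDiagram → A := Classical.epsilon IsTransition

/-- The skew Schur polynomial `U_{λ/μ} = ∑_ν K_{λ/μ,ν} t_ν`. -/
noncomputable def skewU (lam mu : YoungDiagram) : A :=
  ∑ᶠ nu : YoungDiagram, kostka lam mu (toVec nu) • tPoly nu

/-- The integer vector `(1^r) = (1, …, 1)`. -/
noncomputable def onesVec (r : ℕ) : IntVec := ∑ i ∈ Finset.range r, Finsupp.single i 1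

/-- The ring homomorphism `ω : A → A` with `ω(u_r) = v_r = U_{(1^r)}` for `r ≥ 1`. -/
noncomputable def omega : A →+* A :=
  (MvPolynomial.aeval (R := ℤ) fun n : ℕ => schurVec (onesVec (n + 1))).toRingHom

end SchurAlg

namespace SchurAlg

open Finset

/-! ### Determinants -/

/-! Expanding `∏ (1 - R_ij)` like a Vandermonde determinant gives the Jacobi–Trudi form `U_α = det
(u_{α_i - i + j})`, which vanishes as soon as two rows have the same `α_i - i`. Expanding only the
factors that contain the last index (`jt_succ`) and choosing the last entry so that a row repeats
gives `∑_k (-1)^k V_k u_{r-k} = 0`, where `V_k` adds vertical strips of size `k` to `α`. For `α = 0`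
this reads `∑_k (-1)^k v_k u_{r-k} = 0`. The recursion determines the `V_k`, whence the Pieri rule
`v_r U_μ = ∑ U_λ` over vertical strips (`v_mul_U`). The relation between `u` and `v` is symmetric,
so `ω` is an involution and the `v_λ` form a basis; by Pieri they lie in the span of the `U_λ` of
the same size, and counting makes the `U_λ` a basis.

The central point is `ω(U_λ) = U_{λ'}`. Conjugating multiplication by `v_r` with the linear map `U_λ
↦ U_{λ'}` yields an operator that adds horizontal strips. A sign-reversing involution on pairs of
strips (`sum_sign_strips_eq_zero`) shows that these operators satisfy the recursion of the `u_r`, so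
they are multiplication by `u_r` (`horMul_eq`). The linear map therefore sends `v_λ` to `u_λ`, as
`ω` does.

Since `ω` is multiplicative, the symmetry of `c^λ_{μν}` follows. Expanding `u_ν` in Schur
polynomials gives `K_{λ/μ,ν} = ∑_κ K_{κ,ν} c^λ_{μκ}`; summing against `t_ν` turns this into `U_{λ/μ}
= ∑_κ c^λ_{μκ} U_κ`, and applying `ω` gives the last claim. -/

lemma u_zero : u 0 = 1 := rfl

lemma u_neg {r : ℤ} (h : r < 0) : u r = 0 := by
  cases r with
  | ofNat n => simp at h; omega
  | negSucc n => rfl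

lemma u_succ (n : ℕ) : u ((n : ℤ) + 1) = MvPolynomial.X n := rfl

lemma psi_single (al : IntVec) (c : ℤ) : psi (AddMonoidAlgebra.single al c) = c • uMon al := by
  simp [psi]

lemma psi_sum {ι : Type*} (s : Finset ι) (f : ι → AddMonoidAlgebra ℤ IntVec) :
    psi (∑ i ∈ s, f i) = ∑ i ∈ s, psi (f i) := by
  simp [psi, map_sum]

lemma psi_zsmul (c : ℤ) (f : AddMonoidAlgebra ℤ IntVec) : psi (c • f) = c • psi f := by
  rw [psi, AddMonoidAlgebra.coeff_smul, map_smul, psi]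

lemma uMon_eq_prod {al : IntVec} {n : ℕ} (h : ∀ i, n ≤ i → al i = 0) :
    uMon al = ∏ i ∈ range n, u (al i) := by
  refine Finset.prod_subset ?_ ?_
  · intro i hi
    rw [mem_range]
    by_contra hn
    exact (Finsupp.mem_support_iff.mp hi) (h i (by omega))
  · intro i _ hi
    rw [Finsupp.notMem_support_iff.mp hi, u_zero]

/-- The product of the operators `1 - R_{ij}` over `i < j < n`. -/
noncomputable def raisingProd (n : ℕ) : AddMonoidAlgebra ℤ IntVec :=
  ∏ j ∈ range n, ∏ i ∈ range j, (1 - raising i j)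

/-- The Jacobi–Trudi determinant of the first `n` terms of a sequence. -/
noncomputable def jt (n : ℕ) (al : ℕ → ℤ) : A :=
  (Matrix.of fun i j : Fin n => u (al i - i + j)).det

lemma jt_congr {n : ℕ} {al be : ℕ → ℤ} (h : ∀ i < n, al i = be i) : jt n al = jt n be := by
  unfold jt
  congr 1
  ext1 i j
  simp [h i i.2]

lemma jt_eq_zero {n i j : ℕ} {al : ℕ → ℤ} (hi : i < n) (hj : j < n) (hij : i ≠ j)
    (h : al i - i = al j - j) : jt n al = 0 :=
  Matrix.det_zero_of_row_eq (i := ⟨i, hi⟩) (j := ⟨j, hj⟩) (by simpa using hij)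
    (by ext1 k; simp [h])

lemma prod_single (s : Finset ℕ) (b : ℕ → IntVec) :
    ∏ i ∈ s, (AddMonoidAlgebra.single (b i) 1 : AddMonoidAlgebra ℤ IntVec)
      = AddMonoidAlgebra.single (∑ i ∈ s, b i) 1 := by
  induction s using Finset.induction_on with
  | empty => rfl
  | insert a s ha ih => rw [prod_insert ha, sum_insert ha, ih, AddMonoidAlgebra.single_mul_single, one_mul]

/-- Each of the `j` factors `1 - x_i x_j⁻¹` with second index `j` absorbs one `x_j`, which leaves a
Vandermonde product. -/
lemma single_mul_raisingProd (n : ℕ) :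
    AddMonoidAlgebra.single (∑ j ∈ range n, Finsupp.single j (j : ℤ)) 1 * raisingProd n
      = ∏ j ∈ range n, ∏ i ∈ range j,
        (AddMonoidAlgebra.single (Finsupp.single j 1) 1
          - AddMonoidAlgebra.single (Finsupp.single i 1) 1 : AddMonoidAlgebra ℤ IntVec) := by
  rw [raisingProd, ← prod_single, ← prod_mul_distrib]
  refine prod_congr rfl fun j _ => ?_
  have : (AddMonoidAlgebra.single (Finsupp.single j (j : ℤ)) 1 : AddMonoidAlgebra ℤ IntVec)
      = ∏ i ∈ range j, AddMonoidAlgebra.single (Finsupp.single j 1) 1 := by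
    rw [prod_single]
    simp
  rw [this, ← prod_mul_distrib]
  refine prod_congr rfl fun i _ => ?_
  rw [mul_sub, mul_one, raising, AddMonoidAlgebra.single_mul_single]
  simp

lemma prod_range_sub_eq_det {R : Type*} [CommRing R] (n : ℕ) (x : ℕ → R) :
    ∏ j ∈ range n, ∏ i ∈ range j, (x j - x i)
      = ∑ s : Equiv.Perm (Fin n), Equiv.Perm.sign s • ∏ i : Fin n, x i ^ (s i : ℕ) := by
  have h := Matrix.det_vandermonde (fun i : Fin n => x i)
  rw [← Matrix.det_transpose, Matrix.det_apply] at h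
  simp only [Matrix.transpose_apply, Matrix.vandermonde_apply] at h
  rw [h, prod_range]
  rw [Finset.prod_comm' (t' := univ) (s' := fun j => Iio j) (by simp)]
  refine prod_congr rfl fun j _ => ?_
  rw [← Nat.Iio_eq_range, ← Fin.map_valEmbedding_Iio, prod_map]
  rfl

/-- The exponent of the term of the expanded product that belongs to a permutation. -/
noncomputable def permShift {n : ℕ} (s : Equiv.Perm (Fin n)) : IntVec :=
  ∑ i : Fin n, Finsupp.single (i : ℕ) ((s i : ℤ) - i)

lemma permShift_apply {n : ℕ} (s : Equiv.Perm (Fin n)) (i : Fin n) :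
    permShift s i = (s i : ℤ) - i := by
  simp [permShift, Finsupp.single_apply, Fin.val_inj]

lemma permShift_apply_of_le {n : ℕ} (s : Equiv.Perm (Fin n)) {i : ℕ} (h : n ≤ i) :
    permShift s i = 0 := by
  simp only [permShift, Finsupp.finsetSum_apply, Finsupp.single_apply]
  refine sum_eq_zero fun j _ => if_neg ?_
  have := j.2
  omega

lemma raisingProd_eq (n : ℕ) :
    raisingProd n
      = ∑ s : Equiv.Perm (Fin n), Equiv.Perm.sign s • AddMonoidAlgebra.single (permShift s) 1 := by
  have h := single_mul_raisingProd n
  rw [prod_range_sub_eq_det n fun i =>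
    (AddMonoidAlgebra.single (Finsupp.single i 1) 1 : AddMonoidAlgebra ℤ IntVec)] at h
  -- Multiplying by the inverse monomial turns the exponents `s i` into the shifts `s i - i`.
  have h2 := congrArg (fun f => AddMonoidAlgebra.single
    (-∑ j ∈ range n, Finsupp.single j (j : ℤ)) 1 * f) h
  simp only [← mul_assoc, AddMonoidAlgebra.single_mul_single, neg_add_cancel, mul_one,
    ← AddMonoidAlgebra.one_def, one_mul] at h2
  rw [h2, mul_sum]
  refine sum_congr rfl fun s _ => ?_
  rw [mul_smul_comm]
  congr 1
  have : ∏ i : Fin n, (AddMonoidAlgebra.single (Finsupp.single (i : ℕ) 1) 1 :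
      AddMonoidAlgebra ℤ IntVec) ^ (s i : ℕ)
      = AddMonoidAlgebra.single (∑ i : Fin n, Finsupp.single (i : ℕ) (s i : ℤ)) 1 := by
    rw [Finset.univ.prod_congr rfl (g := fun i : Fin n =>
      AddMonoidAlgebra.single (Finsupp.single (i : ℕ) (s i : ℤ)) 1)]
    · induction (univ : Finset (Fin n)) using Finset.induction_on with
      | empty => rfl
      | insert a t ha ih =>
        rw [prod_insert ha, sum_insert ha, ih, AddMonoidAlgebra.single_mul_single, one_mul]
    · intro i _
      rw [AddMonoidAlgebra.single_pow]
      simp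
  rw [this, AddMonoidAlgebra.single_mul_single, mul_one]
  congr 1
  rw [sum_range, permShift, neg_add_eq_sub, ← sum_sub_distrib]
  refine sum_congr rfl fun i _ => ?_
  rw [Finsupp.single_sub]

/-- The permutation expansion becomes the Leibniz formula. Positions from `n` on are not shifted, so
they factor out; `jt_succ` needs one such position. -/
lemma psi_raisingProd_mul {n m : ℕ} (hnm : n ≤ m) {al : IntVec} (h : ∀ i, m ≤ i → al i = 0) :
    psi (raisingProd n * AddMonoidAlgebra.single al 1)
      = jt n al * ∏ i ∈ Ico n m, u (al i) := by
  rw [raisingProd_eq, sum_mul, psi_sum, jt, ← Matrix.det_transpose, Matrix.det_apply, sum_mul]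
  refine sum_congr rfl fun s _ => ?_
  rw [smul_mul_assoc, AddMonoidAlgebra.single_mul_single, mul_one, Units.smul_def, psi_zsmul,
    psi_single, one_smul, Units.smul_def, smul_mul_assoc]
  congr 1
  rw [uMon_eq_prod (n := m) fun i hi => by
    rw [Finsupp.add_apply, h i hi, permShift_apply_of_le s (hnm.trans hi), add_zero]]
  rw [← Finset.prod_range_mul_prod_Ico _ hnm, prod_range]
  congr 1
  · refine prod_congr rfl fun i _ => ?_
    simp only [Matrix.transpose_apply, Matrix.of_apply]
    congr 1
    rw [Finsupp.add_apply, permShift_apply]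
    ring
  · refine prod_congr rfl fun i hi => ?_
    rw [Finsupp.add_apply, permShift_apply_of_le s (mem_Ico.mp hi).1, zero_add]

/-- The indicator sequence of a finite set. -/
def ind (S : Finset ℕ) (i : ℕ) : ℤ := if i ∈ S then 1 else 0

lemma prod_one_sub {R ι : Type*} [CommRing R] [DecidableEq ι] (s : Finset ι) (f : ι → R) :
    ∏ i ∈ s, (1 - f i) = ∑ S ∈ s.powerset, (-1) ^ #S * ∏ i ∈ S, f i := by
  simp only [sub_eq_add_neg, Finset.prod_one_add, prod_neg]

/-- Only the factors `1 - R_{in}` are expanded: choosing `R_{in}` for `i ∈ S` raises the entries in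
`S` and lowers the last one by `#S`. -/
lemma jt_succ (n : ℕ) (al : ℕ → ℤ) :
    jt (n + 1) al
      = ∑ S ∈ (range n).powerset, (-1) ^ #S * (jt n (al + ind S) * u (al n - #S)) := by
  classical
  let be : IntVec := Finsupp.onFinset (range (n + 1)) (fun i => if i < n + 1 then al i else 0)
    (by intro i hi; by_contra hn; rw [mem_range] at hn; exact hi (if_neg hn))
  have hbe : ∀ i < n + 1, be i = al i := fun i hi => if_pos hi
  have hbe0 : ∀ i, n + 1 ≤ i → be i = 0 := fun i hi => if_neg (by omega)
  have h1 := psi_raisingProd_mul le_rfl hbe0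
  rw [Ico_self, prod_empty, mul_one, jt_congr hbe] at h1
  rw [← h1, raisingProd, prod_range_succ, ← raisingProd, prod_one_sub, mul_sum, sum_mul,
    psi_sum]
  refine sum_congr rfl fun S hS => ?_
  have hS' : ∀ i ∈ S, i < n := fun i hi => mem_range.mp (mem_powerset.mp hS hi)
  have hr : ∏ i ∈ S, raising i n = AddMonoidAlgebra.single
      (∑ i ∈ S, (Finsupp.single i 1 - Finsupp.single n 1)) 1 := prod_single _ _
  set ga : IntVec := ∑ i ∈ S, (Finsupp.single i 1 - Finsupp.single n 1) + be with hga
  have hgan : ∀ i < n, ga i = (al + ind S) i := by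
    intro i hi
    have : i ≠ n := by omega
    simp [hga, Finsupp.single_apply, ind, hbe i (by omega), this.symm]
    ring
  have hgan1 : ga n = al n - #S := by
    have : n ∉ S := fun h => by simpa using hS' n h
    simp [hga, Finsupp.single_apply, hbe n (by omega), this]
    ring
  have hga0 : ∀ i, n + 1 ≤ i → ga i = 0 := by
    intro i hi
    have h1 : i ≠ n := by omega
    have h2 : i ∉ S := fun h => by have := hS' i h; omega
    simp [hga, Finsupp.single_apply, hbe0 i hi, h1.symm, h2]
  have h2 := psi_raisingProd_mul n.le_succ hga0
  rw [Nat.Ico_succ_singleton, prod_singleton, hgan1, jt_congr hgan] at h2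
  have h3 : (-1 : AddMonoidAlgebra ℤ IntVec) ^ #S = AddMonoidAlgebra.single 0 ((-1) ^ #S) := by
    rw [show (-1 : AddMonoidAlgebra ℤ IntVec) = AddMonoidAlgebra.single 0 (-1) by
      rw [AddMonoidAlgebra.single_neg]; rfl, AddMonoidAlgebra.single_pow, smul_zero]
  rw [← h2, hr, h3]
  rw [show raisingProd n * (AddMonoidAlgebra.single 0 ((-1) ^ #S) * AddMonoidAlgebra.single
      (∑ i ∈ S, (Finsupp.single i 1 - Finsupp.single n 1)) 1) * AddMonoidAlgebra.single be 1
      = ((-1 : ℤ) ^ #S) • (raisingProd n * AddMonoidAlgebra.single ga 1) by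
    rw [AddMonoidAlgebra.single_mul_single, mul_assoc, AddMonoidAlgebra.single_mul_single,
      ← mul_smul_comm, AddMonoidAlgebra.smul_single, zero_add, hga]
    simp, psi_zsmul, zsmul_eq_mul]
  push_cast
  rfl

lemma jt_succ_of_eq_zero {n : ℕ} {al : ℕ → ℤ} (h : al n = 0) : jt (n + 1) al = jt n al := by
  rw [jt_succ, sum_eq_single ∅]
  · rw [h]
    simp only [card_empty, pow_zero, one_mul, Nat.cast_zero, sub_zero, u_zero, mul_one]
    exact jt_congr fun i _ => by simp [ind]
  · intro S _ hS
    have : 0 < #S := card_pos.mpr (nonempty_iff_ne_empty.mpr hS)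
    rw [h, u_neg (by omega), mul_zero, mul_zero]
  · simp

lemma jt_eq_of_le {n m : ℕ} (hnm : n ≤ m) {al : ℕ → ℤ} (h : ∀ i, n ≤ i → al i = 0) :
    jt m al = jt n al := by
  induction m, hnm using Nat.le_induction with
  | base => rfl
  | succ m hm ih => rw [jt_succ_of_eq_zero (h m hm), ih]

/-- Padding by zeros does not change the determinant, so the length may be replaced by any bound for
it. -/
lemma schurVec_eq_jt {n : ℕ} {al : IntVec} (h : ∀ i, n ≤ i → al i = 0) :
    schurVec al = jt n al := by
  have h0 : ∀ i, length al ≤ i → al i = 0 := by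
    intro i hi
    by_contra hn
    have : i + 1 ≤ length al :=
      Finset.le_sup (f := fun i => i + 1) (Finsupp.mem_support_iff.mpr hn)
    omega
  have hn : length al ≤ n := Finset.sup_le fun i hi => by
    by_contra hlt
    exact Finsupp.mem_support_iff.mp hi (h i (by omega))
  rw [jt_eq_of_le hn h0]
  have := psi_raisingProd_mul le_rfl h0
  rw [Ico_self, prod_empty, mul_one] at this
  exact this

/-- The sum of the determinants of all `al + ind S` with `#S = k`. -/
noncomputable def vertSum (n k : ℕ) (al : ℕ → ℤ) : A :=
  ∑ S ∈ (range n).powersetCard k, jt n (al + ind S)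

lemma jt_succ_eq_sum_vertSum (n : ℕ) (al : ℕ → ℤ) :
    jt (n + 1) al = ∑ k ∈ range (n + 1), (-1) ^ k * (vertSum n k al * u (al n - k)) := by
  rw [jt_succ, Finset.sum_powerset, card_range]
  refine sum_congr rfl fun k _ => ?_
  rw [vertSum, sum_mul, mul_sum]
  refine sum_congr rfl fun S hS => ?_
  rw [(mem_powersetCard.mp hS).2]

lemma sum_vertSum_eq_zero {n m r : ℕ} (hr : 0 < r) (hn : m + r ≤ n) {al : ℕ → ℤ}
    (h : ∀ i, m ≤ i → al i = 0) :
    ∑ k ∈ range (r + 1), (-1) ^ k * (vertSum n k al * u ((r : ℤ) - k)) = 0 := by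
  -- With last entry `r`, rows `n - r` and `n` coincide: `0 - (n - r) = r - n`. The bound `m + r ≤
  -- n` ensures that entry `n - r` is zero.
  have h0 : jt (n + 1) (Function.update al n r) = 0 := by
    refine jt_eq_zero (i := n - r) (j := n) (by omega) (by omega) (by omega) ?_
    rw [Function.update_of_ne (show n - r ≠ n by omega), Function.update_self, h (n - r) (by omega)]
    omega
  rw [jt_succ_eq_sum_vertSum, Function.update_self] at h0
  rw [← h0, ← sum_subset (range_subset_range.mpr (show r + 1 ≤ n + 1 by omega))]
  · refine sum_congr rfl fun k _ => ?_
    congr 2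
    refine sum_congr rfl fun S _ => jt_congr fun i hi => ?_
    simp [Function.update_of_ne hi.ne]
  · intro k _ hk
    rw [mem_range] at hk
    rw [u_neg (by omega), mul_zero, mul_zero]

/-- `v_r = U_{(1^r)}`. -/
noncomputable def v (r : ℕ) : A := schurVec (onesVec r)

lemma onesVec_apply (r i : ℕ) : onesVec r i = ind (range r) i := by
  simp [onesVec, ind, Finsupp.finsetSum_apply, Finsupp.single_apply]

lemma v_eq_jt {r n : ℕ} (h : r ≤ n) : v r = jt n (ind (range r)) := by
  rw [v, schurVec_eq_jt (n := n)]
  · exact jt_congr fun i _ => onesVec_apply r i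
  · intro i hi
    rw [onesVec_apply, ind, if_neg]
    simpa using h.trans hi

lemma v_zero : v 0 = 1 := by
  rw [v_eq_jt le_rfl, jt, Matrix.det_fin_zero]

/-- A set that is not an initial segment has some `i ∉ S` with `i + 1 ∈ S`, and `0 - i = 1 - (i +
1)` gives two equal rows. -/
lemma jt_ind_eq_zero {n : ℕ} {S : Finset ℕ} (hS : S ⊆ range n) (h : S ≠ range (#S)) :
    jt n (0 + ind S) = 0 := by
  have : ∃ i, i ∉ S ∧ i + 1 ∈ S := by
    by_contra! hc
    apply h
    have hc' : ∀ i ∈ S, ∀ j ≤ i, j ∈ S := by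
      intro i hi j hj
      induction hj using Nat.decreasingInduction with
      | self => exact hi
      | of_succ k _ ih => by_contra hk; exact hc k hk ih
    have hsub : S ⊆ range (#S) := by
      intro i hi
      have : range (i + 1) ⊆ S := fun j hj => hc' i hi j (by simpa [Nat.lt_succ_iff] using hj)
      have := card_le_card this
      simpa using this
    exact eq_of_subset_of_card_le hsub (by simp)
  obtain ⟨i, hi, hi1⟩ := this
  have hlt := mem_range.mp (hS hi1)
  refine jt_eq_zero (i := i) (j := i + 1) (by omega) hlt (by omega) ?_
  simp [ind, hi, hi1]

lemma vertSum_zero_eq_v {n k : ℕ} (h : k ≤ n) : vertSum n k 0 = v k := by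
  rw [vertSum, sum_eq_single (range k), v_eq_jt h, zero_add]
  · intro S hS hne
    obtain ⟨h1, h2⟩ := mem_powersetCard.mp hS
    exact jt_ind_eq_zero h1 (by rwa [h2])
  · intro hn
    exact absurd (mem_powersetCard.mpr ⟨range_subset_range.mpr h, card_range k⟩) hn

lemma sum_v_mul_u {r : ℕ} (hr : 0 < r) :
    ∑ k ∈ range (r + 1), (-1) ^ k * (v k * u ((r : ℤ) - k)) = 0 := by
  rw [← sum_vertSum_eq_zero (n := r) (m := 0) (al := 0) hr (by omega) (fun _ _ => rfl)]
  refine sum_congr rfl fun k hk => ?_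
  rw [vertSum_zero_eq_v (by simpa [Nat.lt_succ_iff] using hk)]

/-- The Pieri rule for multiplication by `v_r`, for determinants. -/
lemma v_mul_jt {n m r : ℕ} (hn : m + r ≤ n) {al : ℕ → ℤ} (h : ∀ i, m ≤ i → al i = 0) :
    v r * jt n al = vertSum n r al := by
  induction r using Nat.strong_induction_on with
  | _ r ih =>
    rcases r.eq_zero_or_pos with rfl | hr
    · rw [v_zero, one_mul, vertSum, powersetCard_zero, sum_singleton]
      exact jt_congr fun i _ => by simp [ind]
    -- Both sides satisfy the same recursion, whose top term has the invertible coefficient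
    -- `(-1)^r`.
    · have h1 := sum_vertSum_eq_zero hr hn h
      have h2 := congrArg (· * jt n al) (sum_v_mul_u hr)
      simp only [zero_mul] at h2
      rw [sum_mul] at h2
      rw [sum_range_succ, sub_self, u_zero] at h1 h2
      have h3 : ∑ k ∈ range r, (-1) ^ k * (vertSum n k al * u ((r : ℤ) - k))
          = ∑ k ∈ range r, (-1) ^ k * (v k * u ((r : ℤ) - k)) * jt n al := by
        refine sum_congr rfl fun k hk => ?_
        have hk := mem_range.mp hk
        rw [← ih k hk (by omega)]
        ring
      rw [h3, ← h2] at h1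
      have h4 := add_left_cancel h1
      have h5 : ((-1 : A) ^ r) * ((-1) ^ r) = 1 := by rw [← mul_pow]; simp
      linear_combination (-(-1 : A) ^ r) * h4 + (vertSum n r al - v r * jt n al) * h5

/-! ### The homomorphism `ω` is an involution -/

lemma omega_u (r : ℕ) : omega (u r) = v r := by
  cases r with
  | zero => rw [v_zero, Nat.cast_zero, u_zero, map_one]
  | succ n =>
    rw [Nat.cast_succ, u_succ]
    simp [omega, v]

lemma omega_v (r : ℕ) : omega (v r) = u r := by
  induction r using Nat.strong_induction_on with
  | _ r ih =>
    rcases r.eq_zero_or_pos with rfl | hr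
    · rw [v_zero, Nat.cast_zero, u_zero, map_one]
    · have h1 := congrArg omega (sum_v_mul_u hr)
      -- Reversing the order of summation and multiplying by `(-1)^r` exchanges the roles of `u` and
      -- `v` in the relation.
      have h2 := congrArg (((-1 : A) ^ r) * ·) (sum_v_mul_u hr)
      simp only [mul_zero] at h2
      rw [map_sum, map_zero, sum_range_succ] at h1
      rw [← sum_range_reflect, mul_sum, sum_range_succ] at h2
      have h3 : ∑ k ∈ range r, omega ((-1) ^ k * (v k * u ((r : ℤ) - k)))
          = ∑ k ∈ range r, (-1 : A) ^ r * ((-1) ^ (r + 1 - 1 - k)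
            * (v (r + 1 - 1 - k) * u ((r : ℤ) - (r + 1 - 1 - k : ℕ)))) := by
        refine sum_congr rfl fun k hk => ?_
        have hk := mem_range.mp hk
        obtain ⟨j, rfl⟩ := Nat.exists_eq_add_of_lt hk
        rw [map_mul, map_mul, ih k hk, map_pow, map_neg, map_one,
          show ((k + j + 1 : ℕ) : ℤ) - k = (j + 1 : ℕ) by push_cast; ring, omega_u,
          show k + j + 1 + 1 - 1 - k = j + 1 by omega,
          show ((k + j + 1 : ℕ) : ℤ) - (j + 1 : ℕ) = k by push_cast; ring]
        have h5 : ((-1 : A) ^ (j + 1)) * ((-1) ^ (j + 1)) = 1 := by rw [← mul_pow]; simp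
        rw [show k + j + 1 = k + (j + 1) by ring, pow_add]
        linear_combination (-(-1) ^ k * u k * v (j + 1)) * h5
      rw [h3, ← h2] at h1
      have h4 := add_left_cancel h1
      have h5 : ((-1 : A) ^ r) * ((-1) ^ r) = 1 := by rw [← mul_pow]; simp
      simp only [sub_self, u_zero, Nat.add_sub_cancel, v_zero, map_mul, map_pow, map_neg, map_one,
        mul_one, one_mul, pow_zero, Nat.sub_self, Nat.cast_zero, sub_zero] at h4
      linear_combination ((-1 : A) ^ r) * h4 - (omega (v r) - u r) * h5

lemma omega_omega (f : A) : omega (omega f) = f := by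
  have : omega.comp omega = RingHom.id A := by
    refine MvPolynomial.ringHom_ext ?_ ?_
    · intro c; simp
    · intro n
      rw [RingHom.comp_apply, ← u_succ, ← Nat.cast_succ, omega_u, omega_v]
      rfl
  exact RingHom.congr_fun this f

/-! ### Young diagrams and strips -/

lemma toVec_apply (lam : YoungDiagram) (i : ℕ) : toVec lam i = lam.rowLen i := rfl

lemma rowLen_eq_zero {lam : YoungDiagram} {i : ℕ} (h : lam.card ≤ i) : lam.rowLen i = 0 := by
  by_contra hn
  have h1 : (i, 0) ∈ lam := YoungDiagram.mem_iff_lt_rowLen.mpr (Nat.pos_of_ne_zero hn)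
  rw [YoungDiagram.mem_iff_lt_colLen, YoungDiagram.colLen_eq_card] at h1
  have h2 := card_le_card (filter_subset (fun c : ℕ × ℕ => c.2 = 0) lam.cells)
  exact absurd (h1.trans_le h2) (by simpa using h)

lemma rowLen_le_card (lam : YoungDiagram) (i : ℕ) : lam.rowLen i ≤ lam.card := by
  rw [YoungDiagram.rowLen_eq_card]
  exact card_le_card (filter_subset _ lam.cells)

lemma ext_rowLen {lam mu : YoungDiagram} (h : ∀ i, lam.rowLen i = mu.rowLen i) : lam = mu := by
  apply YoungDiagram.ext
  ext ⟨i, j⟩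
  simp [YoungDiagram.mem_cells, YoungDiagram.mem_iff_lt_rowLen, h]

lemma le_iff_rowLen {lam mu : YoungDiagram} : lam ≤ mu ↔ ∀ i, lam.rowLen i ≤ mu.rowLen i := by
  constructor
  · intro h i
    by_contra! hn
    exact absurd (YoungDiagram.mem_iff_lt_rowLen.mp (h (YoungDiagram.mem_iff_lt_rowLen.mpr hn)))
      (lt_irrefl _)
  · rintro h ⟨i, j⟩ hc
    exact YoungDiagram.mem_iff_lt_rowLen.mpr ((YoungDiagram.mem_iff_lt_rowLen.mp hc).trans_le (h i))

lemma card_eq_sum_rowLen {lam : YoungDiagram} {n : ℕ} (h : lam.rowLen n = 0) :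
    lam.card = ∑ i ∈ range n, lam.rowLen i := by
  rw [YoungDiagram.card, card_eq_sum_card_fiberwise (f := Prod.fst) (t := range n)]
  · exact sum_congr rfl fun i _ => (YoungDiagram.rowLen_eq_card lam).symm
  · rintro ⟨i, j⟩ hc
    have h1 := YoungDiagram.mem_iff_lt_rowLen.mp (YoungDiagram.mem_cells _ |>.mp hc)
    simp only [coe_range, Set.mem_Iio]
    by_contra! hn
    have := lam.rowLen_anti n i hn
    omega

lemma card_transpose (lam : YoungDiagram) : lam.transpose.card = lam.card := by
  simp [YoungDiagram.transpose, YoungDiagram.card]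

lemma finite_card_le (n : ℕ) : {lam : YoungDiagram | lam.card ≤ n}.Finite := by
  refine Set.Finite.of_finite_image (f := YoungDiagram.cells)
    (((range n ×ˢ range n).powerset.finite_toSet).subset ?_)
    (fun a _ b _ h => YoungDiagram.ext h)
  rintro _ ⟨lam, hlam, rfl⟩
  rw [mem_coe, mem_powerset]
  rintro ⟨i, j⟩ hc
  have h1 := YoungDiagram.mem_iff_lt_rowLen.mp (YoungDiagram.mem_cells _ |>.mp hc)
  rw [mem_product, mem_range, mem_range]
  have hlam : lam.card ≤ n := hlam
  refine ⟨?_, (h1.trans_le (rowLen_le_card lam i)).trans_le hlam⟩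
  by_contra! hn
  rw [rowLen_eq_zero (hlam.trans hn)] at h1
  omega

/-- The partitions of size at most `n`. -/
noncomputable def diagLe (n : ℕ) : Finset YoungDiagram := (finite_card_le n).toFinset

lemma mem_diagLe {n : ℕ} {lam : YoungDiagram} : lam ∈ diagLe n ↔ lam.card ≤ n := by
  simp [diagLe]

/-- The partitions of `n`. -/
noncomputable def diag (n : ℕ) : Finset YoungDiagram := (diagLe n).filter (·.card = n)

lemma mem_diag {n : ℕ} {lam : YoungDiagram} : lam ∈ diag n ↔ lam.card = n := by
  simp only [diag, mem_filter, mem_diagLe]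
  omega

/-- The Young diagram with given row lengths. -/
def ofRows (f : ℕ → ℕ) (hf : Antitone f) {n : ℕ} (_hn : f n = 0) : YoungDiagram where
  cells := (range n ×ˢ range (f 0)).filter fun c => c.2 < f c.1
  isLowerSet := by
    rintro ⟨i, j⟩ ⟨i', j'⟩ h hc
    obtain ⟨h1, h2⟩ : i' ≤ i ∧ j' ≤ j := h
    simp only [coe_filter, mem_product, mem_range, Set.mem_ofPred_eq] at hc ⊢
    have := hf h1
    omega

lemma rowLen_ofRows {f : ℕ → ℕ} (hf : Antitone f) {n : ℕ} (hn : f n = 0) (i : ℕ) :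
    (ofRows f hf hn).rowLen i = f i := by
  have h : ∀ j, j < (ofRows f hf hn).rowLen i ↔ j < f i := by
    intro j
    rw [← YoungDiagram.mem_iff_lt_rowLen]
    change (i, j) ∈ (range n ×ˢ range (f 0)).filter (fun c => c.2 < f c.1) ↔ _
    simp only [mem_filter, mem_product, mem_range, and_iff_right_iff_imp]
    intro hj
    refine ⟨?_, hj.trans_le (hf i.zero_le)⟩
    by_contra! hni
    have := hf hni
    omega
  exact le_antisymm (by by_contra! hc; exact absurd ((h _).mp hc) (lt_irrefl _))
    (by by_contra! hc; exact absurd ((h _).mpr hc) (lt_irrefl _))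

lemma U_eq_jt {lam : YoungDiagram} {n : ℕ} (h : lam.rowLen n = 0) :
    U lam = jt n fun i => lam.rowLen i :=
  schurVec_eq_jt fun i hi => by
    have := lam.rowLen_anti n i hi
    rw [toVec_apply]
    omega

/-- `lam / mu` is a vertical strip. -/
def IsVertStrip (mu lam : YoungDiagram) : Prop :=
  ∀ i, mu.rowLen i ≤ lam.rowLen i ∧ lam.rowLen i ≤ mu.rowLen i + 1

/-- `lam / mu` is a horizontal strip. -/
def IsHorStrip (mu lam : YoungDiagram) : Prop :=
  ∀ i, mu.rowLen i ≤ lam.rowLen i ∧ lam.rowLen (i + 1) ≤ mu.rowLen i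

/-- If row `i + 1` of `lam` is longer than row `i` of `mu`, then column `mu.rowLen i` of `lam`
exceeds that of `mu` by at least two cells; the converse is the same argument. -/
lemma isVertStrip_transpose {mu lam : YoungDiagram} :
    IsVertStrip mu.transpose lam.transpose ↔ IsHorStrip mu lam := by
  have key : (∀ j, lam.colLen j ≤ mu.colLen j + 1) ↔
      ∀ i, lam.rowLen (i + 1) ≤ mu.rowLen i := by
    constructor
    · intro h i
      by_contra! hn
      have h1 := YoungDiagram.mem_iff_lt_colLen.mp (YoungDiagram.mem_iff_lt_rowLen.mpr hn)
      have h2 := h (mu.rowLen i)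
      have h3 : i < mu.colLen (mu.rowLen i) := by omega
      exact absurd (YoungDiagram.mem_iff_lt_rowLen.mp (YoungDiagram.mem_iff_lt_colLen.mpr h3))
        (lt_irrefl _)
    · intro h j
      by_contra! hn
      have h1 := YoungDiagram.mem_iff_lt_rowLen.mp (YoungDiagram.mem_iff_lt_colLen.mpr hn)
      have h3 := h1.trans_le (h (mu.colLen j))
      exact absurd (YoungDiagram.mem_iff_lt_colLen.mp (YoungDiagram.mem_iff_lt_rowLen.mpr h3))
        (lt_irrefl _)
  simp only [IsVertStrip, IsHorStrip, forall_and, YoungDiagram.rowLen_transpose, ← key]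
  rw [← le_iff_rowLen, ← YoungDiagram.transpose_le_iff, le_iff_rowLen]
  simp only [YoungDiagram.rowLen_transpose]

open Classical in
/-- The partitions `lam` for which `lam / mu` is a vertical strip with `r` cells. -/
noncomputable def vertStrips (mu : YoungDiagram) (r : ℕ) : Finset YoungDiagram :=
  (diag (mu.card + r)).filter (IsVertStrip mu)

open Classical in
/-- The partitions `lam` for which `lam / mu` is a horizontal strip with `r` cells. -/
noncomputable def horStrips (mu : YoungDiagram) (r : ℕ) : Finset YoungDiagram :=
  (diag (mu.card + r)).filter (IsHorStrip mu)

/-- The Pieri rule for multiplication by `v_r`. -/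
lemma v_mul_U (r : ℕ) (mu : YoungDiagram) : v r * U mu = ∑ lam ∈ vertStrips mu r, U lam := by
  classical
  set n := mu.card + r with hn
  have hmu : ∀ i, mu.card ≤ i → mu.rowLen i = 0 := fun i hi => rowLen_eq_zero hi
  rw [U_eq_jt (n := n) (hmu n (by omega)),
    v_mul_jt (m := mu.card) le_rfl fun i hi => by exact_mod_cast hmu i hi, vertSum]
  symm
  refine sum_of_injOn (fun lam : YoungDiagram =>
    (range n).filter fun i => mu.rowLen i < lam.rowLen i) ?_ ?_ ?_ ?_
  · intro a ha b hb hab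
    simp only [vertStrips, coe_filter, Set.mem_ofPred_eq, mem_diag] at ha hb
    refine ext_rowLen fun i => ?_
    rcases le_or_gt n i with hi | hi
    · rw [rowLen_eq_zero (by omega), rowLen_eq_zero (by omega)]
    · have h1 : i ∈ (range n).filter (fun i => mu.rowLen i < a.rowLen i) ↔
          i ∈ (range n).filter (fun i => mu.rowLen i < b.rowLen i) := by
        simp only at hab
        rw [hab]
      simp only [mem_filter, mem_range, hi, true_and] at h1
      have := ha.2 i
      have := hb.2 i
      omega
  · intro a ha
    simp only [vertStrips, coe_filter, Set.mem_ofPred_eq, mem_diag] at ha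
    rw [mem_coe, mem_powersetCard]
    refine ⟨filter_subset _ _, ?_⟩
    have h1 := card_eq_sum_rowLen (rowLen_eq_zero (lam := a) (i := n) (by omega))
    have h2 := card_eq_sum_rowLen (hmu n (by omega))
    have h3 : ∑ i ∈ range n, a.rowLen i
        = ∑ i ∈ range n, (mu.rowLen i + if mu.rowLen i < a.rowLen i then 1 else 0) := by
      refine sum_congr rfl fun i _ => ?_
      have := ha.2 i
      split_ifs <;> omega
    rw [sum_add_distrib, ← card_filter] at h3
    change #((range n).filter fun i => mu.rowLen i < a.rowLen i) = r
    omega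
  · intro S hS hS'
    obtain ⟨h1, h2⟩ := mem_powersetCard.mp hS
    -- This is the only way in which adding `S` to `mu` can fail to give a partition, and then rows
    -- `i` and `i + 1` of the determinant agree.
    by_cases hanti : ∃ i, i ∉ S ∧ i + 1 ∈ S ∧ mu.rowLen i = mu.rowLen (i + 1)
    · obtain ⟨i, hi, hi1, he⟩ := hanti
      have := mem_range.mp (h1 hi1)
      refine jt_eq_zero (i := i) (j := i + 1) (by omega) this (by omega) ?_
      simp [ind, hi, hi1, he]
    · exfalso
      apply hS'
      push Not at hanti
      have hf : Antitone fun i => mu.rowLen i + if i ∈ S then 1 else 0 := by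
        refine antitone_nat_of_succ_le fun i => ?_
        have := mu.rowLen_anti i (i + 1) (by omega)
        have := hanti i
        split_ifs with h3 h4 <;> first | omega | (have := this h4 h3; omega)
      have hnS : n ∉ S := fun h => absurd (mem_range.mp (h1 h)) (lt_irrefl n)
      have hf0 : mu.rowLen n + (if n ∈ S then 1 else 0) = 0 := by
        simp [hnS, hmu n (by omega)]
      refine ⟨ofRows _ hf hf0, ?_, ?_⟩
      · simp only [vertStrips, coe_filter, Set.mem_ofPred_eq, mem_diag]
        constructor
        · rw [card_eq_sum_rowLen (n := n) (by rw [rowLen_ofRows]; exact hf0)]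
          simp only [rowLen_ofRows, sum_add_distrib]
          rw [← card_eq_sum_rowLen (hmu n (by omega)), ← h2, ← card_filter,
            filter_mem_eq_inter, inter_eq_right.mpr h1]
        · intro i
          rw [rowLen_ofRows]
          split_ifs <;> omega
      · ext i
        simp only [rowLen_ofRows, mem_filter, mem_range]
        constructor
        · rintro ⟨_, h⟩
          by_contra hi
          simp [hi] at h
        · intro h
          exact ⟨mem_range.mp (h1 h), by simp [h]⟩
  · intro a ha
    simp only [vertStrips, mem_filter, mem_diag] at ha
    rw [U_eq_jt (n := n) (rowLen_eq_zero (by omega))]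
    refine jt_congr fun i hi => ?_
    have := ha.2 i
    simp only [Pi.add_apply, ind, mem_filter, mem_range, hi, true_and]
    split_ifs <;> omega

/-! ### Alternating sums over pairs of strips -/

lemma card_le_card_of_le {mu lam : YoungDiagram} (h : mu ≤ lam) : mu.card ≤ lam.card :=
  card_le_card (YoungDiagram.cells_subset_iff.mpr h)

lemma IsVertStrip.le {mu lam : YoungDiagram} (h : IsVertStrip mu lam) : mu ≤ lam :=
  le_iff_rowLen.mpr fun i => (h i).1

lemma IsHorStrip.le {mu lam : YoungDiagram} (h : IsHorStrip mu lam) : mu ≤ lam :=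
  le_iff_rowLen.mpr fun i => (h i).1

/-- The row in which a vertical strip inside `lam / mu` may be changed freely. -/
lemma exists_free_row {mu lam : YoungDiagram} (h : mu ≤ lam) (hne : mu ≠ lam) :
    ∃ i, mu.rowLen i < lam.rowLen i ∧ lam.rowLen (i + 1) ≤ mu.rowLen i := by
  have hle := le_iff_rowLen.mp h
  have hex : ∃ k, ∀ i, k ≤ i → mu.rowLen i = lam.rowLen i :=
    ⟨lam.card, fun i hi => by
      have := hle i
      rw [rowLen_eq_zero hi] at this ⊢
      omega⟩
  -- The row sought is the last one in which the two diagrams differ.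
  classical
  have hk := Nat.find_spec hex
  have hmin := fun m => Nat.find_min hex (m := m)
  rcases hz : Nat.find hex with _ | k
  · rw [hz] at hk
    exact absurd (ext_rowLen fun i => hk i i.zero_le) hne
  · rw [hz] at hk hmin
    refine ⟨k, ?_, ?_⟩
    · by_contra hc
      refine hmin k k.lt_succ_self fun i hi => ?_
      rcases hi.eq_or_lt with rfl | hi
      · have := hle k
        omega
      · exact hk i hi
    · rw [← hk (k + 1) le_rfl]
      exact mu.rowLen_anti _ _ k.le_succ

open Classical in
-- In a free row `i` both lengths `mu.rowLen i` and `mu.rowLen i + 1` are allowed for `ka`, whatever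
-- its other rows are. Switching them changes the size by one, so the terms cancel in pairs.
lemma sum_sign_strips_eq_zero {mu lam : YoungDiagram} (hne : mu ≠ lam) {s : Finset YoungDiagram}
    (hs : ∀ ka, IsVertStrip mu ka → IsHorStrip ka lam → ka ∈ s) :
    ∑ ka ∈ s with IsVertStrip mu ka ∧ IsHorStrip ka lam, (-1 : ℤ) ^ ka.card = 0 := by
  by_cases hle : mu ≤ lam
  swap
  · rw [filter_false_of_mem, sum_empty]
    rintro ka _ ⟨h1, h2⟩
    exact hle (h1.le.trans h2.le)
  obtain ⟨i, hi, hi1⟩ := exists_free_row hle hne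
  let f (ka : YoungDiagram) : ℕ → ℕ :=
    Function.update ka.rowLen i (2 * mu.rowLen i + 1 - ka.rowLen i)
  have hfi : ∀ ka, f ka i = 2 * mu.rowLen i + 1 - ka.rowLen i := fun ka => by simp [f]
  have hfne : ∀ ka j, j ≠ i → f ka j = ka.rowLen j := fun ka j h => by
    simp [f, Function.update_of_ne h]
  have hanti : ∀ ka, IsVertStrip mu ka → IsHorStrip ka lam → Antitone (f ka) := by
    intro ka h1 h2
    refine antitone_nat_of_succ_le fun j => ?_
    have := ka.rowLen_anti j (j + 1) j.le_succ
    have a1 := h1 j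
    have a2 := h2 j
    have a3 := h1 (j + 1)
    have a4 := h2 (j + 1)
    by_cases hj : j = i
    · subst hj
      rw [hfi, hfne _ _ (by omega)]
      omega
    · by_cases hj1 : j + 1 = i
      · subst hj1
        rw [hfi, hfne _ _ (by omega)]
        omega
      · rw [hfne _ _ hj, hfne _ _ hj1]
        exact this
  have hzero : ∀ ka, IsHorStrip ka lam → f ka lam.card = 0 := by
    intro ka h2
    have h3 : lam.rowLen lam.card = 0 := rowLen_eq_zero le_rfl
    have h4 := h2 lam.card
    rw [hfne]
    · omega
    · rintro rfl
      omega
  refine sum_involution (fun ka hka => ofRows (f ka)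
    (hanti ka (mem_filter.mp hka).2.1 (mem_filter.mp hka).2.2)
    (hzero ka (mem_filter.mp hka).2.2)) ?_ ?_ ?_ ?_
  · intro ka hka
    obtain ⟨_, h1, h2⟩ := mem_filter.mp hka
    have c1 := card_eq_sum_rowLen (lam := ka) (n := lam.card) (by
      have h3 : lam.rowLen lam.card = 0 := rowLen_eq_zero le_rfl
      have h4 := h2 lam.card
      omega)
    have c2 := card_eq_sum_rowLen (lam := ofRows (f ka) (hanti ka h1 h2) (hzero ka h2))
      (n := lam.card) (by rw [rowLen_ofRows]; exact hzero ka h2)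
    have hil : i ∈ range lam.card := by
      rw [mem_range]
      by_contra! hc
      rw [rowLen_eq_zero hc] at hi
      omega
    simp only [rowLen_ofRows] at c2
    rw [← add_sum_erase _ _ hil] at c1 c2
    rw [hfi,
      sum_congr rfl (g := fun j => ka.rowLen j) (fun j hj => hfne ka j (ne_of_mem_erase hj))] at c2
    have a := h1 i
    rcases (by omega : ka.rowLen i = mu.rowLen i ∨ ka.rowLen i = mu.rowLen i + 1) with h | h
    · have : (ofRows (f ka) (hanti ka h1 h2) (hzero ka h2)).card = ka.card + 1 := by omega
      rw [this, pow_succ]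
      ring
    · have : ka.card = (ofRows (f ka) (hanti ka h1 h2) (hzero ka h2)).card + 1 := by omega
      rw [this, pow_succ]
      ring
  · intro ka hka _ h
    obtain ⟨_, h1, h2⟩ := mem_filter.mp hka
    have := congrArg (fun k => YoungDiagram.rowLen k i) h
    simp only [rowLen_ofRows, hfi] at this
    have := h1 i
    omega
  · intro ka hka
    obtain ⟨_, h1, h2⟩ := mem_filter.mp hka
    have hv : IsVertStrip mu (ofRows (f ka) (hanti ka h1 h2) (hzero ka h2)) := by
      intro j
      rw [rowLen_ofRows]
      have := h1 j
      by_cases hj : j = i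
      · subst hj
        rw [hfi]
        omega
      · rw [hfne _ _ hj]
        exact this
    have hh : IsHorStrip (ofRows (f ka) (hanti ka h1 h2) (hzero ka h2)) lam := by
      intro j
      rw [rowLen_ofRows]
      have := h1 j
      have := h2 j
      by_cases hj : j = i
      · subst hj
        rw [hfi]
        omega
      · rw [hfne _ _ hj]
        assumption
    exact mem_filter.mpr ⟨hs _ hv hh, hv, hh⟩
  · intro ka hka
    obtain ⟨_, h1, h2⟩ := mem_filter.mp hka
    refine ext_rowLen fun j => ?_
    rw [rowLen_ofRows]
    by_cases hj : j = i
    · subst hj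
      rw [hfi, rowLen_ofRows, hfi]
      have := h1 j
      omega
    · rw [hfne _ _ hj, rowLen_ofRows, hfne _ _ hj]

/-! ### Bases -/

/-- A family that spans the members of an independent family with the same index set, in a way
that is compatible with the sizes of partitions, is independent. -/
lemma linearIndependent_of_mem_span {a b : YoungDiagram → A} (ha : LinearIndependent ℤ a)
    (h : ∀ nu : YoungDiagram,
      a nu ∈ Submodule.span ℤ (b '' {lam | lam.card = nu.card})) :
    LinearIndependent ℤ b := by
  have key : ∀ n, LinearIndependent ℤ fun lam : diagLe n => b lam := by
    intro n
    let M := Submodule.span ℤ (Set.range fun lam : diagLe n => b lam)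
    have hM : M = LinearMap.range (Finsupp.linearCombination ℤ fun lam : diagLe n => b lam) :=
      (Finsupp.range_linearCombination ℤ).symm
    have : Module.Finite ℤ M := Module.Finite.span_of_finite ℤ (Set.finite_range _)
    have hb : ∀ l, Finsupp.linearCombination ℤ (fun lam : diagLe n => b lam) l ∈ M := fun l => by
      rw [hM]
      exact LinearMap.mem_range_self _ l
    have ha' : ∀ l, Finsupp.linearCombination ℤ (fun lam : diagLe n => a lam) l ∈ M := fun l => by
      refine Submodule.sum_mem _ fun nu _ => Submodule.smul_mem _ _ ?_
      refine Submodule.span_mono ?_ (h nu)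
      rintro _ ⟨lam, hlam, rfl⟩
      have hlam : lam.card = (nu : YoungDiagram).card := hlam
      exact ⟨⟨lam, mem_diagLe.mpr (hlam.trans_le (mem_diagLe.mp nu.2))⟩, rfl⟩
    -- The free module on `diagLe n` injects into `M` by `a` and maps onto `M` by `b`; the Orzech
    -- property makes the second map injective too.
    have hinj := OrzechProperty.injective_of_surjective_of_injective
      ((Finsupp.linearCombination ℤ fun lam : diagLe n => a lam).codRestrict M ha')
      ((Finsupp.linearCombination ℤ fun lam : diagLe n => b lam).codRestrict M hb)
      (by
        have h1 : LinearIndependent ℤ fun lam : diagLe n => a lam :=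
          ha.comp _ Subtype.val_injective
        intro x y hxy
        exact h1 (congrArg Subtype.val hxy))
      (by
        rintro ⟨x, hx⟩
        obtain ⟨l, hl⟩ := hM ▸ hx
        exact ⟨l, Subtype.ext hl⟩)
    intro x y hxy
    exact hinj (Subtype.ext hxy)
  rw [linearIndependent_iff_finset_linearIndependent]
  intro s
  have hs : ∀ lam ∈ s, lam ∈ diagLe (s.sup YoungDiagram.card) := fun lam h =>
    mem_diagLe.mpr (Finset.le_sup (f := YoungDiagram.card) h)
  exact (key (s.sup YoungDiagram.card)).comp (fun lam : s => ⟨lam, hs lam lam.2⟩)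
    fun x y hxy => Subtype.ext (congrArg (fun z : diagLe _ => (z : YoungDiagram)) hxy)

lemma uMon_toVec (lam : YoungDiagram) :
    uMon (toVec lam) = ∏ i ∈ range lam.card, u (lam.rowLen i : ℕ) :=
  uMon_eq_prod fun i hi => by rw [toVec_apply, rowLen_eq_zero hi]; rfl

/-- The exponent of the monomial `u_λ`. -/
noncomputable def exponent (lam : YoungDiagram) : ℕ →₀ ℕ :=
  Multiset.toFinsupp (Multiset.map Nat.pred lam.rowLens)

lemma map_succ_pred_rowLens (lam : YoungDiagram) :
    Multiset.map Nat.succ (Multiset.map Nat.pred lam.rowLens) = lam.rowLens := by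
  rw [Multiset.map_map]
  conv_rhs => rw [← Multiset.map_id (lam.rowLens : Multiset ℕ)]
  refine Multiset.map_congr rfl fun x hx => ?_
  exact Nat.succ_pred_eq_of_pos (lam.pos_of_mem_rowLens x hx)

/-- A partition is a multiset of positive parts; each part is lowered by one because `X n` stands
for `u_{n+1}`. -/
lemma exponent_bijective : Function.Bijective exponent := by
  constructor
  · intro a b h
    have h1 := Multiset.toFinsupp.injective h
    have h2 := congrArg (Multiset.map Nat.succ) h1
    rw [map_succ_pred_rowLens, map_succ_pred_rowLens, Multiset.coe_eq_coe] at h2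
    have h3 := h2.eq_of_pairwise' a.rowLens_sorted.pairwise b.rowLens_sorted.pairwise
    rw [← a.ofRowLens_to_rowLens_eq_self, ← b.ofRowLens_to_rowLens_eq_self]
    congr 1
  · intro d
    let s : Multiset ℕ := Multiset.map Nat.succ (Finsupp.toMultiset d)
    have hs : (s.sort (· ≥ ·)).SortedGE := (s.pairwise_sort (· ≥ ·)).sortedGE
    refine ⟨YoungDiagram.ofRowLens _ hs, ?_⟩
    rw [exponent, YoungDiagram.rowLens_ofRowLens_eq_self, Multiset.sort_eq, Multiset.map_map]
    · simp
    · intro x hx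
      rw [Multiset.mem_sort, Multiset.mem_map] at hx
      obtain ⟨y, _, rfl⟩ := hx
      exact y.succ_pos

lemma uMon_toVec_eq_monomial (lam : YoungDiagram) :
    uMon (toVec lam) = MvPolynomial.monomial (exponent lam) 1 := by
  have h1 : uMon (toVec lam) = (Multiset.map (fun r : ℕ => u r) lam.rowLens).prod := by
    rw [uMon_eq_prod (n := lam.colLen 0), YoungDiagram.rowLens, Multiset.map_coe, List.map_map,
      Multiset.prod_coe]
    · rfl
    · intro i hi
      rw [toVec_apply]
      by_contra hn
      have h2 : 0 < lam.rowLen i := by omega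
      have := YoungDiagram.mem_iff_lt_colLen.mp (YoungDiagram.mem_iff_lt_rowLen.mpr h2)
      omega
  rw [h1, ← map_succ_pred_rowLens, Multiset.map_map]
  unfold exponent
  induction (Multiset.map Nat.pred (lam.rowLens : Multiset ℕ)) using Multiset.induction_on with
  | empty => simp
  | cons a s ih =>
    rw [Multiset.map_cons, Multiset.prod_cons, ih, ← Multiset.singleton_add, map_add,
      Multiset.toFinsupp_singleton, Function.comp_apply, Nat.cast_succ, u_succ, MvPolynomial.X,
      MvPolynomial.monomial_mul, one_mul]

/-- The basis of the monomials `u_λ`. -/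
noncomputable def uBasis : Module.Basis YoungDiagram ℤ A :=
  (MvPolynomial.basisMonomials ℕ ℤ).reindex (Equiv.ofBijective _ exponent_bijective).symm

lemma uBasis_apply (lam : YoungDiagram) : uBasis lam = uMon (toVec lam) := by
  rw [uBasis, Module.Basis.reindex_apply, uMon_toVec_eq_monomial]
  rfl

/-- `omega` as a linear automorphism. -/
noncomputable def omegaEquiv : A ≃ₗ[ℤ] A :=
  LinearEquiv.ofInvolutive omega.toIntAlgHom.toLinearMap omega_omega

lemma omegaEquiv_apply (f : A) : omegaEquiv f = omega f := rfl

/-- The basis of the monomials `v_λ`. -/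
noncomputable def vBasis : Module.Basis YoungDiagram ℤ A := uBasis.map omegaEquiv

lemma vBasis_apply (lam : YoungDiagram) :
    vBasis lam = ∏ i ∈ range lam.card, v (lam.rowLen i) := by
  rw [vBasis, Module.Basis.map_apply, uBasis_apply, omegaEquiv_apply, uMon_toVec, map_prod]
  exact prod_congr rfl fun i _ => omega_u _

lemma card_bot : (⊥ : YoungDiagram).card = 0 := rfl

lemma rowLen_bot (i : ℕ) : (⊥ : YoungDiagram).rowLen i = 0 := rowLen_eq_zero (by rw [card_bot]; exact i.zero_le)

lemma U_bot : U ⊥ = 1 := by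
  rw [U_eq_jt (n := 0) (rowLen_bot 0), jt, Matrix.det_fin_zero]

/-- Iterates an abstract Pieri rule, so that it serves both for `v` with vertical strips and for `u`
with horizontal ones. -/
lemma prod_mul_mem_span {w : ℕ → A} {strips : YoungDiagram → ℕ → Finset YoungDiagram}
    (hw : ∀ r mu, w r * U mu = ∑ lam ∈ strips mu r, U lam)
    (hs : ∀ r mu, ∀ lam ∈ strips mu r, mu ≤ lam ∧ lam.card = mu.card + r)
    (mu : YoungDiagram) (s : Finset ℕ) (f : ℕ → ℕ) :
    (∏ i ∈ s, w (f i)) * U mu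
      ∈ Submodule.span ℤ (U '' {lam | mu ≤ lam ∧ lam.card = mu.card + ∑ i ∈ s, f i}) := by
  classical
  induction s using Finset.induction_on with
  | empty =>
    rw [prod_empty, one_mul]
    exact Submodule.subset_span ⟨mu, ⟨le_rfl, by simp⟩, rfl⟩
  | insert a s ha ih =>
    rw [prod_insert ha, sum_insert ha, mul_assoc]
    generalize (∏ i ∈ s, w (f i)) * U mu = x at ih
    induction ih using Submodule.span_induction with
    | mem x hx =>
      obtain ⟨lam, ⟨h1, h2⟩, rfl⟩ := hx
      rw [hw]
      refine Submodule.sum_mem _ fun ka hka => Submodule.subset_span ⟨ka, ?_, rfl⟩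
      obtain ⟨h3, h4⟩ := hs _ _ _ hka
      exact ⟨h1.trans h3, by omega⟩
    | zero => simp
    | add x y _ _ hx hy => rw [mul_add]; exact Submodule.add_mem _ hx hy
    | smul c x _ hx => rw [mul_smul_comm]; exact Submodule.smul_mem _ _ hx

lemma mem_vertStrips {mu lam : YoungDiagram} {r : ℕ} :
    lam ∈ vertStrips mu r ↔ lam.card = mu.card + r ∧ IsVertStrip mu lam := by
  classical
  rw [vertStrips, mem_filter, mem_diag]

lemma mem_horStrips {mu lam : YoungDiagram} {r : ℕ} :
    lam ∈ horStrips mu r ↔ lam.card = mu.card + r ∧ IsHorStrip mu lam := by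
  classical
  rw [horStrips, mem_filter, mem_diag]

lemma vBasis_mem_span (nu : YoungDiagram) :
    vBasis nu ∈ Submodule.span ℤ (U '' {lam | lam.card = nu.card}) := by
  have h := prod_mul_mem_span v_mul_U
    (fun r mu lam h => ⟨(mem_vertStrips.mp h).2.le, (mem_vertStrips.mp h).1⟩) ⊥
    (range nu.card) nu.rowLen
  rw [U_bot, mul_one, ← vBasis_apply, ← card_eq_sum_rowLen (rowLen_eq_zero le_rfl)] at h
  refine Submodule.span_mono (Set.image_mono ?_) h
  rintro lam ⟨_, h⟩
  simpa [card_bot] using h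

lemma linearIndependent_U : LinearIndependent ℤ U :=
  linearIndependent_of_mem_span vBasis.linearIndependent vBasis_mem_span

lemma span_U : Submodule.span ℤ (Set.range U) = ⊤ := by
  rw [eq_top_iff, ← vBasis.span_eq, Submodule.span_le]
  rintro _ ⟨nu, rfl⟩
  exact Submodule.span_mono (Set.image_subset_range _ _) (vBasis_mem_span nu)

/-- The basis of the Schur polynomials. -/
noncomputable def schurBasis : Module.Basis YoungDiagram ℤ A :=
  Module.Basis.mk linearIndependent_U span_U.ge

lemma schurBasis_apply (lam : YoungDiagram) : schurBasis lam = U lam :=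
  Module.Basis.mk_apply _ _ _

lemma coe_schurBasis : ⇑schurBasis = U := funext schurBasis_apply

lemma schurCoeff_eq_repr (f : A) : schurCoeff f = schurBasis.repr f := by
  have h0 : Finsupp.linearCombination ℤ U (schurBasis.repr f) = f := by
    rw [← coe_schurBasis]
    exact schurBasis.linearCombination_repr f
  have h := Classical.epsilon_spec (p := fun c => Finsupp.linearCombination ℤ U c = f) ⟨_, h0⟩
  exact linearIndependent_U (h.trans h0.symm)

/-! ### The involution on Schur polynomials -/

/-- The linear map `U_λ ↦ U_{λ'}`. -/
noncomputable def conjMap : A →ₗ[ℤ] A := schurBasis.constr ℤ fun lam => U lam.transpose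

lemma conjMap_U (lam : YoungDiagram) : conjMap (U lam) = U lam.transpose := by
  rw [← schurBasis_apply lam, conjMap, Module.Basis.constr_basis]

lemma conjMap_conjMap (f : A) : conjMap (conjMap f) = f := by
  have : conjMap ∘ₗ conjMap = LinearMap.id := schurBasis.ext fun lam => by
    rw [schurBasis_apply, LinearMap.comp_apply, conjMap_U, conjMap_U,
      YoungDiagram.transpose_transpose, LinearMap.id_apply]
  exact LinearMap.congr_fun this f

/-- Multiplication by `v_r`, conjugated by `conjMap`. -/
noncomputable def horMul (r : ℕ) : A →ₗ[ℤ] A :=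
  conjMap ∘ₗ LinearMap.mulLeft ℤ (v r) ∘ₗ conjMap

lemma horMul_apply (r : ℕ) (f : A) : horMul r f = conjMap (v r * conjMap f) := rfl

lemma horMul_U (r : ℕ) (mu : YoungDiagram) :
    horMul r (U mu) = ∑ lam ∈ horStrips mu r, U lam := by
  rw [horMul_apply, conjMap_U, v_mul_U, map_sum]
  refine sum_nbij' YoungDiagram.transpose YoungDiagram.transpose ?_ ?_ ?_ ?_ ?_
  · intro lam h
    rw [mem_vertStrips, card_transpose] at h
    rw [mem_horStrips, card_transpose, ← isVertStrip_transpose, YoungDiagram.transpose_transpose]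
    exact h
  · intro lam h
    rw [mem_horStrips, ← isVertStrip_transpose] at h
    rw [mem_vertStrips, card_transpose, card_transpose]
    exact h
  · exact fun lam _ => lam.transpose_transpose
  · exact fun lam _ => lam.transpose_transpose
  · exact fun lam _ => conjMap_U lam

/-- The coefficient of `U lam` is, up to a global sign, the alternating sum over `ka` with `ka / mu`
a vertical and `lam / ka` a horizontal strip. It vanishes since `r > 0` forces `lam ≠ mu`. -/
lemma sum_horMul_v_mul {r : ℕ} (hr : 0 < r) (mu : YoungDiagram) :
    ∑ k ∈ range (r + 1), (-1) ^ k * horMul (r - k) (v k * U mu) = 0 := by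
  classical
  set N := mu.card + r with hN
  set s := (diagLe N).filter (IsVertStrip mu) with hs
  have h1 : ∀ k ∈ range (r + 1), (-1) ^ k * horMul (r - k) (v k * U mu)
      = ∑ ka ∈ s with ka.card - mu.card = k, (-1) ^ (ka.card - mu.card) *
        ∑ lam ∈ diag N with IsHorStrip ka lam, U lam := by
    intro k hk
    have hk := mem_range.mp hk
    have h2 : vertStrips mu k = s.filter fun ka => ka.card - mu.card = k := by
      ext ka
      simp only [mem_vertStrips, hs, mem_filter, mem_diagLe]
      constructor
      · rintro ⟨h3, h4⟩
        exact ⟨⟨by omega, h4⟩, by omega⟩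
      · rintro ⟨⟨_, h4⟩, h5⟩
        have := card_le_card_of_le h4.le
        exact ⟨by omega, h4⟩
    rw [v_mul_U, map_sum, mul_sum, ← h2]
    refine sum_congr rfl fun ka hka => ?_
    have hka := (mem_vertStrips.mp hka).1
    rw [horMul_U, hka, Nat.add_sub_cancel_left]
    congr 1
    refine sum_congr ?_ fun _ _ => rfl
    ext lam
    rw [mem_horStrips, mem_filter, mem_diag, hka, hN,
      show mu.card + k + (r - k) = mu.card + r by omega]
  rw [sum_congr rfl h1, sum_fiberwise_of_maps_to]
  swap
  · intro ka hka
    rw [hs, mem_filter, mem_diagLe] at hka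
    rw [mem_range]
    omega
  simp only [mul_sum]
  rw [sum_comm' (t' := diag N) (s' := fun lam => s.filter fun ka => IsHorStrip ka lam)
    (by intro x y; simp only [mem_filter]; tauto)]
  refine sum_eq_zero fun lam hlam => ?_
  have hlam := mem_diag.mp hlam
  have hz := sum_sign_strips_eq_zero (mu := mu) (lam := lam) (s := diagLe N)
    (by rintro rfl; omega)
    (fun ka _ h => mem_diagLe.mpr ((card_le_card_of_le h.le).trans hlam.le))
  rw [← filter_filter] at hz
  have hz' := congrArg (fun c : ℤ => (-1 : A) ^ mu.card * ((c : A) * U lam)) hz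
  simp only [Int.cast_sum, Int.cast_pow, Int.cast_neg, Int.cast_one, Int.cast_zero, zero_mul,
    mul_zero, sum_mul, mul_sum] at hz'
  rw [← hz']
  refine sum_congr rfl fun ka hka => ?_
  rw [mem_filter, mem_filter] at hka
  have hle := card_le_card_of_le hka.1.2.le
  obtain ⟨j, hj⟩ := Nat.exists_eq_add_of_le hle
  rw [hj, Nat.add_sub_cancel_left, pow_add]
  have h5 : ((-1 : A) ^ mu.card) * ((-1) ^ mu.card) = 1 := by rw [← mul_pow]; simp
  linear_combination (-(-1) ^ j * U lam) * h5

/-- Both operators obey the same recursion against the `v_k`; for `r > 0` all terms with `k ≥ 1`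
agree by induction, which leaves `k = 0`. -/
lemma horMul_eq (r : ℕ) (f : A) : horMul r f = u r * f := by
  induction r using Nat.strong_induction_on generalizing f with
  | _ r ih =>
    rcases r.eq_zero_or_pos with rfl | hr
    · rw [horMul_apply, v_zero, one_mul, conjMap_conjMap, Nat.cast_zero, u_zero, one_mul]
    · have : horMul r = LinearMap.mulLeft ℤ (u r) := schurBasis.ext fun mu => by
        rw [schurBasis_apply, LinearMap.mulLeft_apply]
        have h1 := sum_horMul_v_mul hr mu
        have h2 := congrArg (· * U mu) (sum_v_mul_u hr)
        simp only [zero_mul, sum_mul] at h2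
        rw [sum_range_succ'] at h1 h2
        have h3 : ∑ k ∈ range r, (-1) ^ (k + 1) * horMul (r - (k + 1)) (v (k + 1) * U mu)
            = ∑ k ∈ range r,
              (-1) ^ (k + 1) * (v (k + 1) * u ((r : ℤ) - (k + 1 : ℕ))) * U mu := by
          refine sum_congr rfl fun k hk => ?_
          have hk := mem_range.mp hk
          rw [ih _ (by omega), Nat.cast_sub (by omega)]
          ring
        rw [h3, ← h2] at h1
        have h4 := add_left_cancel h1
        simpa [v_zero] using h4
      rw [this, LinearMap.mulLeft_apply]

/-- The Pieri rule for multiplication by `u_r`. -/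
lemma u_mul_U (r : ℕ) (mu : YoungDiagram) : u r * U mu = ∑ lam ∈ horStrips mu r, U lam := by
  rw [← horMul_eq, horMul_U]

lemma conjMap_v_mul (r : ℕ) (f : A) : conjMap (v r * f) = u r * conjMap f := by
  rw [← horMul_eq, horMul_apply, conjMap_conjMap]

lemma transpose_bot : (⊥ : YoungDiagram).transpose = ⊥ := by
  apply YoungDiagram.ext
  rfl

/-- `conjMap` turns each factor `v_r` into `u_r`, so the two maps agree on the basis `v_λ`, although
only `omega` is multiplicative by construction. -/
lemma conjMap_eq_omega (f : A) : conjMap f = omega f := by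
  have key : ∀ (s : Finset ℕ) (g : ℕ → ℕ),
      conjMap (∏ i ∈ s, v (g i)) = ∏ i ∈ s, u (g i : ℕ) := by
    classical
    intro s g
    induction s using Finset.induction_on with
    | empty => rw [prod_empty, prod_empty, ← U_bot, conjMap_U, transpose_bot]
    | insert a s ha ih => rw [prod_insert ha, prod_insert ha, conjMap_v_mul, ih]
  have : conjMap = omegaEquiv.toLinearMap := vBasis.ext fun lam => by
    rw [vBasis_apply, key, LinearEquiv.coe_coe, omegaEquiv_apply, map_prod]
    exact prod_congr rfl fun i _ => (omega_v _).symm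
  rw [this]
  rfl

lemma omega_U (lam : YoungDiagram) : omega (U lam) = U lam.transpose := by
  rw [← conjMap_eq_omega, conjMap_U]

/-! ### Kostka numbers and Littlewood–Richardson coefficients -/

lemma finsum_repr {ι : Type*} (b : Module.Basis ι ℤ A) (f : A) : ∑ᶠ i, b.repr f i • b i = f := by
  rw [finsum_eq_sum_of_support_subset (s := (b.repr f).support)]
  · exact b.linearCombination_repr f
  · intro i hi
    rw [mem_coe, Finsupp.mem_support_iff]
    intro h
    exact hi (by simp [h])

lemma sum_repr_of_subset {ι : Type*} (b : Module.Basis ι ℤ A) (f : A) {t : Finset ι}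
    (h : ∀ i, b.repr f i ≠ 0 → i ∈ t) : ∑ i ∈ t, b.repr f i • b i = f := by
  conv_rhs => rw [← finsum_repr b f]
  rw [finsum_eq_sum_of_support_subset]
  intro i hi
  exact h i fun h0 => hi (by simp [h0])

/-- The transition matrices between two bases are inverse to each other. This replaces any
triangularity of the Kostka matrix. -/
lemma sum_repr_mul_repr {ι : Type*} (b c : Module.Basis ι ℤ A) (i k : ι) {t : Finset ι}
    (h : ∀ j, c.repr (b i) j ≠ 0 → j ∈ t) :
    ∑ j ∈ t, b.repr (c j) k * c.repr (b i) j = Finsupp.single i 1 k := by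
  rw [← b.repr_self i]
  conv_rhs => rw [← sum_repr_of_subset c (b i) h]
  rw [map_sum, Finsupp.finsetSum_apply]
  refine sum_congr rfl fun j _ => ?_
  rw [map_smul, Finsupp.smul_apply, smul_eq_mul, mul_comm]

lemma uMon_mul_mem_span (al : IntVec) (mu : YoungDiagram) :
    uMon al * U mu ∈ Submodule.span ℤ
      (U '' {lam | mu ≤ lam ∧ (lam.card : ℤ) = mu.card + ∑ i ∈ al.support, al i}) := by
  -- A negative entry makes the monomial zero; otherwise the Pieri rule for `u` applies.
  by_cases hneg : ∃ i ∈ al.support, al i < 0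
  · obtain ⟨i, hi, hlt⟩ := hneg
    rw [uMon, prod_eq_zero hi (u_neg hlt), zero_mul]
    exact Submodule.zero_mem _
  · push Not at hneg
    have h1 : ∀ i ∈ al.support, ((al i).toNat : ℤ) = al i := fun i hi =>
      Int.toNat_of_nonneg (hneg i hi)
    have h2 := prod_mul_mem_span (w := fun r => u r) u_mul_U
      (fun r mu lam h => ⟨(mem_horStrips.mp h).2.le, (mem_horStrips.mp h).1⟩) mu
      al.support (fun i => (al i).toNat)
    rw [prod_congr rfl fun i hi => congrArg u (h1 i hi)] at h2
    refine Submodule.span_mono (Set.image_mono ?_) h2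
    rintro lam ⟨h3, h4⟩
    refine ⟨h3, ?_⟩
    rw [h4, ← sum_congr rfl h1]
    push_cast
    rfl

lemma kostka_eq_repr (lam mu : YoungDiagram) (al : IntVec) :
    kostka lam mu al = schurBasis.repr (uMon al * U mu) lam := by
  rw [kostka, schurCoeff_eq_repr]

lemma lr_eq_repr (lam mu nu : YoungDiagram) :
    lr lam mu nu = schurBasis.repr (U mu * U nu) lam := by
  rw [lr, schurCoeff_eq_repr]

lemma le_and_card_of_kostka_ne_zero {lam mu : YoungDiagram} {al : IntVec}
    (h : kostka lam mu al ≠ 0) :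
    mu ≤ lam ∧ (lam.card : ℤ) = mu.card + ∑ i ∈ al.support, al i := by
  have h1 := uMon_mul_mem_span al mu
  rw [← coe_schurBasis, Module.Basis.mem_span_image, coe_schurBasis] at h1
  exact h1 (Finsupp.mem_support_iff.mpr (by rwa [← kostka_eq_repr]))

lemma sum_toVec (nu : YoungDiagram) : ∑ i ∈ (toVec nu).support, toVec nu i = nu.card := by
  rw [card_eq_sum_rowLen (rowLen_eq_zero le_rfl)]
  push_cast
  refine sum_subset ?_ ?_
  · intro i hi
    rw [mem_range]
    by_contra! hn
    rw [Finsupp.mem_support_iff, toVec_apply, rowLen_eq_zero hn] at hi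
    exact hi rfl
  · intro i _ hi
    exact Finsupp.notMem_support_iff.mp hi

lemma card_eq_of_kostka_ne_zero {lam mu nu : YoungDiagram}
    (h : kostka lam mu (toVec nu) ≠ 0) : lam.card = mu.card + nu.card := by
  have := (le_and_card_of_kostka_ne_zero h).2
  rw [sum_toVec] at this
  exact_mod_cast this

lemma kostka_bot (lam nu : YoungDiagram) :
    kostka lam ⊥ (toVec nu) = schurBasis.repr (uBasis nu) lam := by
  rw [kostka_eq_repr, U_bot, mul_one, uBasis_apply]

lemma card_eq_of_repr_uBasis_ne_zero {lam nu : YoungDiagram}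
    (h : schurBasis.repr (uBasis nu) lam ≠ 0) : lam.card = nu.card := by
  rw [← kostka_bot] at h
  simpa [card_bot] using card_eq_of_kostka_ne_zero h

/-- The projection to the span of the Schur polynomials of the partitions of `n`. -/
noncomputable def degProj (n : ℕ) : A →ₗ[ℤ] A :=
  schurBasis.constr ℤ fun lam => if lam.card = n then U lam else 0

lemma degProj_U (n : ℕ) (lam : YoungDiagram) :
    degProj n (U lam) = if lam.card = n then U lam else 0 := by
  conv_lhs => rw [← schurBasis_apply lam]
  rw [degProj, Module.Basis.constr_basis]

lemma degProj_uBasis (n : ℕ) (nu : YoungDiagram) :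
    degProj n (uBasis nu) = if nu.card = n then uBasis nu else 0 := by
  have h := sum_repr_of_subset schurBasis (uBasis nu) (t := diag nu.card)
    fun lam hl => mem_diag.mpr (card_eq_of_repr_uBasis_ne_zero hl)
  conv_lhs => rw [← h]
  rw [map_sum]
  split_ifs with hn
  · conv_rhs => rw [← h]
    refine sum_congr rfl fun lam hl => ?_
    rw [map_smul, schurBasis_apply, degProj_U, if_pos ((mem_diag.mp hl).trans hn)]
  · refine sum_eq_zero fun lam hl => ?_
    rw [map_smul, schurBasis_apply, degProj_U, if_neg (by rwa [mem_diag.mp hl]), smul_zero]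

lemma card_eq_of_repr_U_ne_zero {lam nu : YoungDiagram}
    (h : uBasis.repr (U lam) nu ≠ 0) : nu.card = lam.card := by
  by_contra hne
  apply h
  -- Each `u_κ` is homogeneous for the grading by Schur polynomials, so the projection keeps or
  -- kills it, and the surviving ones differ from `u_ν` in size.
  have key : uBasis.coord nu ∘ₗ degProj lam.card = 0 := uBasis.ext fun ka => by
    rw [LinearMap.comp_apply, degProj_uBasis]
    split_ifs with hk
    · rw [Module.Basis.coord_apply, Module.Basis.repr_self, LinearMap.zero_apply,
        Finsupp.single_eq_of_ne]
      rintro rfl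
      exact hne hk
    · rw [map_zero, LinearMap.zero_apply]
  have h1 := LinearMap.congr_fun key (U lam)
  rwa [LinearMap.comp_apply, degProj_U, if_pos rfl] at h1

/-- The family `t_ν`, by the inverse of the matrix of Kostka numbers. -/
noncomputable def tFamily (nu : YoungDiagram) : A :=
  ∑ lam ∈ diag nu.card, uBasis.repr (U lam) nu • U lam

lemma isTransition_iff {t : YoungDiagram → A} :
    IsTransition t ↔ ∀ lam : YoungDiagram,
      U lam = ∑ nu ∈ diag lam.card, schurBasis.repr (uBasis nu) lam • t nu := by
  refine forall_congr' fun lam => ?_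
  rw [finsum_eq_sum_of_support_subset (s := diag lam.card)]
  · simp only [kostka_bot]
  · intro nu hnu
    rw [mem_coe, mem_diag]
    refine (card_eq_of_repr_uBasis_ne_zero (nu := nu) (lam := lam) fun h0 => hnu ?_).symm
    simp only [kostka_bot, h0, zero_smul]

lemma isTransition_tFamily : IsTransition tFamily := by
  rw [isTransition_iff]
  intro lam
  have h1 : ∀ nu ∈ diag lam.card, schurBasis.repr (uBasis nu) lam • tFamily nu
      = ∑ ka ∈ diag lam.card,
        (schurBasis.repr (uBasis nu) lam * uBasis.repr (schurBasis ka) nu) • U ka := by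
    intro nu hnu
    rw [tFamily, mem_diag.mp hnu, smul_sum]
    refine sum_congr rfl fun ka _ => ?_
    rw [smul_smul, schurBasis_apply]
  rw [sum_congr rfl h1, sum_comm]
  have h2 : ∀ ka ∈ diag lam.card, ∑ nu ∈ diag lam.card,
      (schurBasis.repr (uBasis nu) lam * uBasis.repr (schurBasis ka) nu) • U ka
      = (Finsupp.single ka (1 : ℤ) lam) • U ka := by
    intro ka hka
    rw [← sum_smul, sum_repr_mul_repr]
    intro nu hnu
    rw [schurBasis_apply] at hnu
    exact mem_diag.mpr ((card_eq_of_repr_U_ne_zero hnu).trans (mem_diag.mp hka))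
  rw [sum_congr rfl h2, sum_eq_single lam]
  · simp
  · intro ka _ hne
    rw [Finsupp.single_eq_of_ne hne.symm, zero_smul]
  · intro h
    exact absurd (mem_diag.mpr rfl) h

/-- Existence used one product of the two transition matrices; uniqueness uses the product in the
other order. -/
lemma IsTransition.eq_tFamily {t : YoungDiagram → A} (ht : IsTransition t) : t = tFamily := by
  rw [isTransition_iff] at ht
  funext nu
  have h1 : ∀ lam ∈ diag nu.card, uBasis.repr (U lam) nu • U lam
      = ∑ ka ∈ diag nu.card,
        (uBasis.repr (schurBasis lam) nu * schurBasis.repr (uBasis ka) lam) • t ka := by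
    intro lam hlam
    conv_lhs => arg 2; rw [ht lam]
    rw [mem_diag.mp hlam, smul_sum]
    refine sum_congr rfl fun ka _ => ?_
    rw [smul_smul, schurBasis_apply]
  rw [tFamily, sum_congr rfl h1, sum_comm]
  have h2 : ∀ ka ∈ diag nu.card, ∑ lam ∈ diag nu.card,
      (uBasis.repr (schurBasis lam) nu * schurBasis.repr (uBasis ka) lam) • t ka
      = (Finsupp.single ka (1 : ℤ) nu) • t ka := by
    intro ka hka
    rw [← sum_smul, sum_repr_mul_repr]
    intro lam hlam
    exact mem_diag.mpr ((card_eq_of_repr_uBasis_ne_zero hlam).trans (mem_diag.mp hka))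
  rw [sum_congr rfl h2, sum_eq_single nu]
  · simp
  · intro ka _ hne
    rw [Finsupp.single_eq_of_ne hne.symm, zero_smul]
  · intro h
    exact absurd (mem_diag.mpr rfl) h

lemma isTransition_tPoly : IsTransition tPoly :=
  Classical.epsilon_spec (p := IsTransition) ⟨_, isTransition_tFamily⟩

lemma IsTransition.eq_tPoly {t : YoungDiagram → A} (ht : IsTransition t) : t = tPoly :=
  ht.eq_tFamily.trans isTransition_tPoly.eq_tFamily.symm

lemma U_eq_sum_tPoly (lam : YoungDiagram) :
    U lam = ∑ nu ∈ diag lam.card, schurBasis.repr (uBasis nu) lam • tPoly nu :=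
  isTransition_iff.mp isTransition_tPoly lam

lemma U_mem_span_tPoly (lam : YoungDiagram) :
    U lam ∈ Submodule.span ℤ (tPoly '' {nu | nu.card = lam.card}) := by
  rw [U_eq_sum_tPoly]
  exact Submodule.sum_mem _ fun nu hnu =>
    Submodule.smul_mem _ _ (Submodule.subset_span ⟨nu, mem_diag.mp hnu, rfl⟩)

lemma linearIndependent_tPoly : LinearIndependent ℤ tPoly :=
  linearIndependent_of_mem_span linearIndependent_U U_mem_span_tPoly

lemma span_tPoly : Submodule.span ℤ (Set.range tPoly) = ⊤ := by
  rw [eq_top_iff, ← span_U, Submodule.span_le]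
  rintro _ ⟨nu, rfl⟩
  exact Submodule.span_mono (Set.image_subset_range _ _) (U_mem_span_tPoly nu)

/-! ### Littlewood–Richardson coefficients and skew Schur polynomials -/

lemma card_eq_of_lr_ne_zero {lam mu nu : YoungDiagram} (h : lr lam mu nu ≠ 0) :
    lam.card = mu.card + nu.card := by
  by_contra hne
  apply h
  rw [lr_eq_repr, ← sum_repr_of_subset uBasis (U nu) (t := diag nu.card)
    fun ka hka => mem_diag.mpr (card_eq_of_repr_U_ne_zero hka), mul_sum, map_sum,
    Finsupp.finsetSum_apply]
  refine sum_eq_zero fun ka hka => ?_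
  rw [mul_smul_comm, map_smul, Finsupp.smul_apply, mul_comm, uBasis_apply, ← kostka_eq_repr]
  by_contra h0
  have := card_eq_of_kostka_ne_zero (right_ne_zero_of_smul h0)
  rw [mem_diag.mp hka] at this
  exact hne this

/-- Expand `u_ν` in Schur polynomials before multiplying by `U_μ`. -/
lemma kostka_eq_sum_lr (lam mu nu : YoungDiagram) :
    kostka lam mu (toVec nu)
      = ∑ ka ∈ diag nu.card, schurBasis.repr (uBasis nu) ka * lr lam mu ka := by
  rw [kostka_eq_repr, ← uBasis_apply]
  conv_lhs => rw [← sum_repr_of_subset schurBasis (uBasis nu) (t := diag nu.card)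
    fun ka hka => mem_diag.mpr (card_eq_of_repr_uBasis_ne_zero hka)]
  rw [sum_mul, map_sum, Finsupp.finsetSum_apply]
  refine sum_congr rfl fun ka _ => ?_
  rw [smul_mul_assoc, map_smul, Finsupp.smul_apply, smul_eq_mul, schurBasis_apply,
    mul_comm (U ka), lr_eq_repr]

/-- After exchanging the sums, the inner sum over `ν` is the transition equation for `U_κ`. -/
lemma skewU_eq_sum {lam mu : YoungDiagram} {d : ℕ} (hd : lam.card = mu.card + d) :
    skewU lam mu = ∑ nu ∈ diag d, lr lam mu nu • U nu := by
  rw [skewU, finsum_eq_sum_of_support_subset (s := diag d)]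
  swap
  · intro nu hnu
    have := card_eq_of_kostka_ne_zero (lam := lam) (mu := mu) (nu := nu)
      fun h0 => hnu (by simp only [h0, zero_smul])
    exact mem_diag.mpr (by omega)
  have h1 : ∀ nu ∈ diag d, kostka lam mu (toVec nu) • tPoly nu
      = ∑ ka ∈ diag d, lr lam mu ka • (schurBasis.repr (uBasis nu) ka • tPoly nu) := by
    intro nu hnu
    rw [kostka_eq_sum_lr, mem_diag.mp hnu, sum_smul]
    refine sum_congr rfl fun ka _ => ?_
    rw [smul_smul, mul_comm]
  rw [sum_congr rfl h1, sum_comm]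
  refine sum_congr rfl fun ka hka => ?_
  rw [← smul_sum, U_eq_sum_tPoly, mem_diag.mp hka]

/-- `omega` permutes the Schur basis by conjugation, hence permutes coordinates. -/
lemma repr_omega (f : A) (lam : YoungDiagram) :
    schurBasis.repr (omega f) lam.transpose = schurBasis.repr f lam := by
  classical
  rw [← conjMap_eq_omega]
  have : schurBasis.coord lam.transpose ∘ₗ conjMap = schurBasis.coord lam :=
    schurBasis.ext fun ka => by
      rw [LinearMap.comp_apply, schurBasis_apply, conjMap_U, ← schurBasis_apply,
        ← schurBasis_apply, Module.Basis.coord_apply, Module.Basis.coord_apply,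
        Module.Basis.repr_self, Module.Basis.repr_self, Finsupp.single_apply, Finsupp.single_apply]
      simp only [YoungDiagram.transpose_eq_iff]
  exact LinearMap.congr_fun this f

lemma lr_transpose (lam mu nu : YoungDiagram) :
    lr lam.transpose mu.transpose nu.transpose = lr lam mu nu := by
  rw [lr_eq_repr, lr_eq_repr, ← omega_U, ← omega_U, ← map_mul, repr_omega]

lemma omega_skewU {lam mu : YoungDiagram} (h : mu ≤ lam) :
    omega (skewU lam mu) = skewU lam.transpose mu.transpose := by
  obtain ⟨d, hd⟩ := Nat.exists_eq_add_of_le (card_le_card_of_le h)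
  rw [skewU_eq_sum hd, skewU_eq_sum (d := d) (by rw [card_transpose, card_transpose, hd]), map_sum]
  refine sum_nbij' YoungDiagram.transpose YoungDiagram.transpose ?_ ?_ ?_ ?_ ?_
  · intro nu hnu
    rwa [mem_diag, card_transpose, ← mem_diag]
  · intro nu hnu
    rwa [mem_diag, card_transpose, ← mem_diag]
  · exact fun nu _ => nu.transpose_transpose
  · exact fun nu _ => nu.transpose_transpose
  · intro nu _
    rw [lr_transpose, map_zsmul, omega_U]

end SchurAlg

theorem mainTheorem7 :
    -- the `U_λ` form a `ℤ`-basis of `A`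
    (LinearIndependent ℤ SchurAlg.U ∧ Submodule.span ℤ (Set.range SchurAlg.U) = ⊤) ∧
    -- `u_α U_μ = ∑_{λ ⊇ μ} K_{λ/μ,α} U_λ`, a finite sum
    (∀ (mu : YoungDiagram) (al : SchurAlg.IntVec),
      {lam | SchurAlg.kostka lam mu al ≠ 0}.Finite ∧
      (∀ lam, SchurAlg.kostka lam mu al ≠ 0 → mu ≤ lam) ∧
      SchurAlg.uMon al * SchurAlg.U mu =
        ∑ᶠ lam, SchurAlg.kostka lam mu al • SchurAlg.U lam) ∧
    -- `U_μ U_ν = ∑_λ c^λ_{μν} U_λ`, a finite sum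
    (∀ mu nu : YoungDiagram,
      {lam | SchurAlg.lr lam mu nu ≠ 0}.Finite ∧
      SchurAlg.U mu * SchurAlg.U nu = ∑ᶠ lam, SchurAlg.lr lam mu nu • SchurAlg.U lam) ∧
    -- `∑_ν K_{λ/μ,ν} t_ν` is a finite sum
    (∀ lam mu : YoungDiagram, mu ≤ lam →
      {nu | SchurAlg.kostka lam mu (SchurAlg.toVec nu) ≠ 0}.Finite) ∧
    -- the `t_λ` are the unique solution of the transition equations, and a `ℤ`-basis of `A`
    (SchurAlg.IsTransition SchurAlg.tPoly ∧
      (∀ t, SchurAlg.IsTransition t → t = SchurAlg.tPoly) ∧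
      LinearIndependent ℤ SchurAlg.tPoly ∧
      Submodule.span ℤ (Set.range SchurAlg.tPoly) = ⊤) ∧
    -- `U_{λ/μ} = ∑_ν c^λ_{μν} U_ν`, a finite sum
    (∀ lam mu : YoungDiagram, mu ≤ lam →
      {nu | SchurAlg.lr lam mu nu ≠ 0}.Finite ∧
      SchurAlg.skewU lam mu = ∑ᶠ nu, SchurAlg.lr lam mu nu • SchurAlg.U nu) ∧
    -- `c^λ_{μν} = c^{λ'}_{μ'ν'}`
    (∀ lam mu nu : YoungDiagram,
      SchurAlg.lr lam mu nu = SchurAlg.lr lam.transpose mu.transpose nu.transpose) ∧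
    -- `ω(U_{λ/μ}) = U_{λ'/μ'}`
    (∀ lam mu : YoungDiagram, mu ≤ lam →
      SchurAlg.omega (SchurAlg.skewU lam mu) =
        SchurAlg.skewU lam.transpose mu.transpose) := by
  open SchurAlg in
  refine ⟨⟨linearIndependent_U, span_U⟩, ?_, ?_, ?_, ⟨isTransition_tPoly,
    fun _ h => h.eq_tPoly, linearIndependent_tPoly, span_tPoly⟩, ?_,
    fun lam mu nu => (lr_transpose lam mu nu).symm, fun _ _ h => omega_skewU h⟩
  · intro mu al
    refine ⟨?_, fun lam h => (le_and_card_of_kostka_ne_zero h).1, ?_⟩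
    · simp only [kostka_eq_repr]
      exact Finsupp.hasFiniteSupport _
    · simp only [kostka_eq_repr, ← schurBasis_apply]
      exact (finsum_repr _ _).symm
  · intro mu nu
    constructor
    · simp only [lr_eq_repr]
      exact Finsupp.hasFiniteSupport _
    · simp only [lr_eq_repr, ← schurBasis_apply]
      exact (finsum_repr _ _).symm
  · intro lam mu _
    refine (finite_card_le lam.card).subset fun nu hnu => ?_
    have := card_eq_of_kostka_ne_zero hnu
    exact (by omega : nu.card ≤ lam.card)
  · intro lam mu h
    obtain ⟨d, hd⟩ := Nat.exists_eq_add_of_le (card_le_card_of_le h)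
    constructor
    · refine (finite_card_le lam.card).subset fun nu hnu => ?_
      have := card_eq_of_lr_ne_zero hnu
      exact (by omega : nu.card ≤ lam.card)
    · rw [skewU_eq_sum hd, finsum_eq_sum_of_support_subset]
      intro nu hnu
      have := card_eq_of_lr_ne_zero (lam := lam) (mu := mu) (nu := nu)
        fun h0 => hnu (by simp only [h0, zero_smul])
      exact Finset.mem_coe.mpr (mem_diag.mpr (by omega))
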